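/- Let $\sigma=\tfrac12$, $\delta=\tfrac52$, $L=20$, $t=8$, let $$\psi_0(x')=e^{i\pi/4}e^{-(x'-\delta)^2/(4\sigma^2)}+e^{-i\pi/4}e^{-(x'+\delta)^2/(4\sigma^2)},\qquad G(x,t)=\frac{e^{-i\pi/4}}{\sqrt{2\pi t}}\,e^{ix^2/(2t)},$$ and let $\psi(x,t)=\int_{-\infty}^{\infty}G(x-x',t)\,\psi_0(x')\,dx'$ be the solution of the free Schrödinger equation $i\partial_t\psi=-\tfrac12\partial_x^2\psi$ with initial wave function $\psi_0$. For an even integer $J\ge 2$ put $h=L/J$ and $x_j'=(j-J/2)h$ for $0\le j\le J-1$, and let $$\tilde\psi(x,t)=h\sum_{j=0}^{J-1}G(x-x_j',t)\,\psi_0(x_j')$$ be the discrete Green's function approximation. Then for every even integer $J\ge2$ and every $c>0$ $$\|\tilde\psi(\cdot,t)-\psi(\cdot,t)\|_{L^\infty[-40,40]}\le\Gamma_c(J):=\frac{e^{\frac{257}{256}c^2+\frac{85}{16}c}}{e^{\pi cJ/10}-1}+4.22\times10^{-24},$$ and $|\tilde\psi(x,t)-\psi(x,t)|\le\Gamma_c(J)$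 at every $x\in[-40,40]$. More precisely, for $x\in[-40,40]$ let $f(x')=G(x-x',t)\psi_0(x')$. Then $f$ is integrable on $\mathbb R$, $\sum_{j\in\mathbb Z}f(jh)$ converges absolutely, and $$|\tilde\psi(x,t)-\psi(x,t)|\le\mathcal E_{\mathrm{trunc}}+\mathcal E_{\mathrm{discr}},\qquad \mathcal E_{\mathrm{trunc}}=\Big|\tilde\psi(x,t)-h\sum_{j\in\mathbb Z}f(jh)\Big|,\quad \mathcal E_{\mathrm{discr}}=\Big|h\sum_{j\in\mathbb Z}f(jh)-\int_{-\infty}^\infty f(x')\,dx'\Big|.$$ With $\operatorname{erfc}(z)=\frac{2}{\sqrt\pi}\int_z^\infty e^{-u^2}du$ and $$B(J)=\frac{4}{\sqrt{2\pi t}}\frac{L}{J}e^{-\frac{(L/2-\delta)^2}{4\sigma^2}}+\frac{4}{\sqrt{2\pi t}}\sqrt\pi\,\sigma\operatorname{erfc}\Big(\frac{L-2\delta}{4\sigma}\Big),$$ the two parts satisfy $$\mathcal E_{\mathrm{trunc}}\le B(J)\le B(1)<4.22\times10^{-24},\qquad \mathcal E_{\mathrm{discr}}\le\frac{e^{\frac{257}{256}c^2+\left(\frac18|x|+\frac5{16}\right)c}}{e^{\pi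 cJ/10}-1}.$$ -/

import Mathlib

open MeasureTheory Set

noncomputable section

namespace FreeWavePacket

/-- The one-dimensional free-particle propagator (Green's function), in units with `ℏ = m = 1`:
`G(x, t) = e^{-iπ/4} / √(2πt) * e^{i x² / (2t)}`. -/
def propagator (x t : ℝ) : ℂ :=
  Complex.exp (-Complex.I * Real.pi / 4) / (Real.sqrt (2 * Real.pi * t) : ℂ) *
    Complex.exp (Complex.I * (x : ℂ) ^ 2 / (2 * (t : ℂ)))

/-- The superposition of two phase-shifted Gaussian wave packets of width `σ` centred at `± δ`. -/
def twoGaussians (σ δ : ℝ) (x : ℝ) : ℂ :=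
  Complex.exp (Complex.I * Real.pi / 4) * (Real.exp (-(x - δ) ^ 2 / (4 * σ ^ 2)) : ℂ) +
    Complex.exp (-Complex.I * Real.pi / 4) * (Real.exp (-(x + δ) ^ 2 / (4 * σ ^ 2)) : ℂ)

/-- The integrand `x' ↦ G(x - x', t) ψ₀(x')` of the Green's function representation. -/
def integrand (ψ₀ : ℝ → ℂ) (x t : ℝ) (x' : ℝ) : ℂ :=
  propagator (x - x') t * ψ₀ x'

/-- The exact solution `ψ(x, t) = ∫ G(x - x', t) ψ₀(x') dx'` with initial wave function `ψ₀`. -/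
def solution (ψ₀ : ℝ → ℂ) (x t : ℝ) : ℂ :=
  ∫ x' : ℝ, integrand ψ₀ x t x'

/-- The mesh size `h = L / J` of the initial domain `[-L/2, L/2]`. -/
def meshSize (L : ℝ) (J : ℕ) : ℝ := L / J

/-- The grid points `x'_j = (j - J/2) h`, `j = 0, …, J - 1` (with division in the reals). -/
def gridPoint (L : ℝ) (J j : ℕ) : ℝ := ((j : ℝ) - (J : ℝ) / 2) * meshSize L J

/-- The discrete Green's function approximation
`ψ̃(x, t) = h ∑_{j=0}^{J-1} G(x - x'_j, t) ψ₀(x'_j)`. -/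
def approximation (ψ₀ : ℝ → ℂ) (L : ℝ) (J : ℕ) (x t : ℝ) : ℂ :=
  (meshSize L J : ℂ) *
    ∑ j ∈ Finset.range J, propagator (x - gridPoint L J j) t * ψ₀ (gridPoint L J j)

/-- The trapezoidal sum on the whole real line, `h ∑_{j ∈ ℤ} f(j h)`. -/
def trapezoidalSum (f : ℝ → ℂ) (h : ℝ) : ℂ := (h : ℂ) * ∑' j : ℤ, f ((j : ℝ) * h)

/-- The truncation error `|ψ̃(x, t) - h ∑_{j ∈ ℤ} f(j h)|`, with `f` the integrand at `(x, t)`. -/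
def truncationError (ψ₀ : ℝ → ℂ) (L : ℝ) (J : ℕ) (x t : ℝ) : ℝ :=
  ‖approximation ψ₀ L J x t - trapezoidalSum (integrand ψ₀ x t) (meshSize L J)‖

/-- The discretization error `|h ∑_{j ∈ ℤ} f(j h) - ∫ f|`, with `f` the integrand at `(x, t)`. -/
def discretizationError (ψ₀ : ℝ → ℂ) (L : ℝ) (J : ℕ) (x t : ℝ) : ℝ :=
  ‖trapezoidalSum (integrand ψ₀ x t) (meshSize L J) - solution ψ₀ x t‖

/-- The complementary error function `erfc(x) = 2 / √π ∫_x^∞ e^{-u²} du`. -/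
def erfc (x : ℝ) : ℝ := 2 / Real.sqrt Real.pi * ∫ u in Ioi x, Real.exp (-u ^ 2)

/-- The bound of the truncation error for the two Gaussians:
`4 / √(2πt) * (L / J) * e^{-(L/2 - δ)² / (4σ²)} + 4 / √(2πt) * √π σ erfc((L - 2δ) / (4σ))`. -/
def truncationBound (σ δ L t : ℝ) (J : ℕ) : ℝ :=
  4 / Real.sqrt (2 * Real.pi * t) * (L / J) * Real.exp (-(L / 2 - δ) ^ 2 / (4 * σ ^ 2)) +
    4 / Real.sqrt (2 * Real.pi * t) * (Real.sqrt Real.pi * σ * erfc ((L - 2 * δ) / (4 * σ)))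

/-- The total error bound
`Γ_c(J) = e^{(257/256) c² + (85/16) c} / (e^{πcJ/10} - 1) + 4.22 * 10^{-24}`. -/
def errorBound (c : ℝ) (J : ℕ) : ℝ :=
  Real.exp (257 / 256 * c ^ 2 + 85 / 16 * c) / (Real.exp (Real.pi * c * J / 10) - 1) +
    4.22 * (10 : ℝ) ^ (-24 : ℤ)

end FreeWavePacket

end

/-! For fixed `x` each packet contributes to the integrand a constant times `exp(-a y² + b y + d)`
with `Re a = 1`. By Poisson summation (`trapezoidalSum_quadExp`) the trapezoidal sum is a series
over frequencies `ξ = n/h` whose `n = 0` term is the integral, so the discretization error is the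
sum over `n ≠ 0`. The coefficients are Gaussian in `ξ` (`quadCoeff_exponent_re`). Completing a
square with the free parameter `c` replaces this by geometric decay (`quadCoeff_exponent_re_le`),
which sums in closed form.

The truncation error needs only `|G|`, which is constant: outside `[-10, 10]` the packets are
Gaussian tails, and the tail sums are compared with integrals (`mesh_mul_sum_exp_neg_sq_le`). -/

noncomputable section

namespace FreeWavePacket


/-! ### Poisson summation for quadratic exponentials -/

/-- The exponential `y ↦ exp(-a y² + b y + d)` of a quadratic polynomial on the real line. -/
def quadExp (a b d : ℂ) (y : ℝ) : ℂ := Complex.exp (-a * (y : ℂ) ^ 2 + b * y + d)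

lemma integrable_quadExp {a : ℂ} (ha : 0 < a.re) (b d : ℂ) : Integrable (quadExp a b d) :=
  integrable_cexp_quadratic ha b d

lemma quadExp_mul (a b d : ℂ) (y h : ℝ) :
    quadExp a b d (y * h) = Complex.exp d *
      Complex.exp (-(Real.pi : ℂ) * (a * h ^ 2 / Real.pi) * (y : ℂ) ^ 2 +
        2 * Real.pi * (b * h / (2 * Real.pi)) * y) := by
  have hpi : (Real.pi : ℂ) ≠ 0 := by exact_mod_cast Real.pi_ne_zero
  rw [quadExp, ← Complex.exp_add]
  congr 1
  push_cast
  field_simp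
  ring

/-- The terms are `exp d` times Jacobi theta terms with `τ = i h² a / π`, and `Im τ > 0` because `Re
a > 0`. -/
lemma summable_quadExp {a : ℂ} (ha : 0 < a.re) (b d : ℂ) {h : ℝ} (hh : 0 < h) :
    Summable fun j : ℤ => quadExp a b d (j * h) := by
  have hpi : (Real.pi : ℂ) ≠ 0 := by exact_mod_cast Real.pi_ne_zero
  have h1 := (summable_jacobiTheta₂_term_iff (-Complex.I * (b * h / (2 * Real.pi)))
    (Complex.I * (((h ^ 2 / Real.pi : ℝ) : ℂ) * a))).2 (by
      rw [Complex.I_mul_im, Complex.re_ofReal_mul]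
      have := Real.pi_pos
      positivity)
  refine (h1.mul_left (Complex.exp d)).congr fun j => ?_
  rw [quadExp_mul, jacobiTheta₂_term]
  congr 2
  push_cast
  field_simp
  linear_combination (a * h ^ 2 * j ^ 2 - b * h * j) * Complex.I_sq

/-- The Fourier coefficients of `quadExp a b d` that enter Poisson summation with mesh size `h`. -/
def quadCoeff (a b d : ℂ) (h : ℝ) (n : ℤ) : ℂ :=
  Complex.exp ((b - 2 * Real.pi * Complex.I * n / h) ^ 2 / (4 * a) + d)

/-- The zeroth coefficient does not depend on `h`; this form lets it cancel in the Poisson series.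
-/
lemma integral_quadExp {a : ℂ} (ha : 0 < a.re) (b d : ℂ) (h : ℝ) :
    ∫ y, quadExp a b d y = (Real.pi / a) ^ (1 / 2 : ℂ) * quadCoeff a b d h 0 := by
  have h1 := integral_cexp_quadratic (b := -a) (by simpa using ha) b d
  rw [neg_neg] at h1
  simp only [quadExp, h1, quadCoeff]
  congr 2
  simp only [Int.cast_zero, mul_zero, zero_div, sub_zero, mul_neg, div_neg, sub_neg_eq_add]
  ring

/-- Poisson summation for exponentials of quadratic polynomials. -/
theorem trapezoidalSum_quadExp {a : ℂ} (ha : 0 < a.re) (b d : ℂ) {h : ℝ} (hh : 0 < h) :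
    trapezoidalSum (quadExp a b d) h =
      (Real.pi / a) ^ (1 / 2 : ℂ) * ∑' n : ℤ, quadCoeff a b d h n := by
  have hpi : (Real.pi : ℂ) ≠ 0 := by exact_mod_cast Real.pi_ne_zero
  have hpos := Real.pi_pos
  have hh0 : (h : ℂ) ≠ 0 := by exact_mod_cast hh.ne'
  have ha0 : a ≠ 0 := by rintro rfl; simp at ha
  set a' : ℂ := a * h ^ 2 / Real.pi with ha'
  have hre : 0 < a'.re := by
    have : a' = ((h ^ 2 / Real.pi : ℝ) : ℂ) * a := by rw [ha']; push_cast; ring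
    rw [this, Complex.re_ofReal_mul]
    positivity
  -- The principal branches are matched by evaluating one Gaussian integral before and after the
  -- scaling `y ↦ y h`.
  have hroot : (h : ℂ) * (1 / a' ^ (1 / 2 : ℂ)) = (Real.pi / a) ^ (1 / 2 : ℂ) := by
    have harg : a'.arg ≠ Real.pi := fun he => by
      have := (Complex.arg_eq_pi_iff.1 he).1
      linarith
    have h1 := Measure.integral_comp_mul_right (fun y : ℝ => Complex.exp (-a * (y : ℂ) ^ 2)) h
    have h2 := integral_gaussian_complex (b := Real.pi * a')
      (by rw [Complex.re_ofReal_mul]; positivity)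
    have e : ∀ y : ℝ, Complex.exp (-a * ((y * h : ℝ) : ℂ) ^ 2) =
        Complex.exp (-(Real.pi * a') * (y : ℂ) ^ 2) := fun y => by
      rw [ha']; congr 1; push_cast; field_simp
    simp only [e] at h1
    rw [h2, integral_gaussian_complex ha, abs_of_pos (inv_pos.2 hh), ← div_div, div_self hpi,
      one_div, Complex.inv_cpow _ _ harg, Complex.real_smul, Complex.ofReal_inv] at h1
    rw [one_div, h1, mul_inv_cancel_left₀ hh0]
  rw [trapezoidalSum]
  simp only [quadExp_mul]
  have := Complex.tsum_exp_neg_quadratic hre (b * h / (2 * Real.pi))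
  simp only [Complex.ofReal_intCast]
  rw [tsum_mul_left, this, ← hroot, mul_left_comm (Complex.exp d), mul_assoc (h : ℂ),
    ← tsum_mul_left (a := Complex.exp d)]
  congr 3
  funext n
  rw [quadCoeff, ← Complex.exp_add, ha']
  congr 1
  field_simp
  linear_combination -(16 * Real.pi ^ 2 * n ^ 2 + 4 * h ^ 2 * b ^ 2) * Complex.I_sq

lemma hasSum_exp_neg_mul_natAbs {r : ℝ} (hr : 0 < r) :
    HasSum (fun n : ℤ => if n = 0 then 0 else Real.exp (-r * |(n : ℝ)|))
      (2 / (Real.exp r - 1)) := by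
  have hq : Real.exp (-r) < 1 := by simpa using hr
  have h0 : HasSum (fun n : ℕ => Real.exp (-r * (n + 1))) (1 / (Real.exp r - 1)) := by
    have h1 := (hasSum_geometric_of_lt_one (Real.exp_nonneg (-r)) hq).mul_left (Real.exp (-r))
    have e : Real.exp (-r) * (1 - Real.exp (-r))⁻¹ = 1 / (Real.exp r - 1) := by
      have : 1 < Real.exp r := by simpa using hr
      have : Real.exp r - 1 ≠ 0 := by linarith
      rw [Real.exp_neg]
      field_simp
    rw [e] at h1
    refine h1.congr_fun fun n => ?_
    rw [← Real.exp_nat_mul, ← Real.exp_add]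
    ring_nf
  have h2 : HasSum (fun n : ℕ => if (n : ℤ) = 0 then 0 else Real.exp (-r * |((n : ℤ) : ℝ)|))
      (1 / (Real.exp r - 1)) := by
    rw [← hasSum_nat_add_iff' 1]
    simp only [Finset.range_one, Finset.sum_singleton]
    simp only [Nat.cast_zero, if_true, sub_zero]
    refine h0.congr_fun fun n => ?_
    rw [if_neg (by positivity), Int.cast_natCast, Nat.cast_add_one, abs_of_nonneg (by positivity)]
  have h3 := h2.of_nat_of_neg_add_one (f := fun n : ℤ =>
    if n = 0 then 0 else Real.exp (-r * |(n : ℝ)|)) (m' := 1 / (Real.exp r - 1)) (by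
      refine h0.congr_fun fun n => ?_
      rw [if_neg (by omega), Int.cast_neg, abs_neg, Int.cast_add, Int.cast_one, Int.cast_natCast,
        abs_of_nonneg (by positivity)])
  convert h3 using 1
  ring

/-- The trapezoidal rule for the exponential of a quadratic polynomial converges geometrically. -/
theorem norm_trapezoidalSum_quadExp_sub_integral_le {a : ℂ} (ha : 0 < a.re) (ha1 : 1 ≤ ‖a‖)
    (b d : ℂ) {h : ℝ} (hh : 0 < h) {K r : ℝ} (hr : 0 < r)
    (hK : ∀ n : ℤ, n ≠ 0 →
      ((b - 2 * Real.pi * Complex.I * n / h) ^ 2 / (4 * a) + d).re ≤ K - r * |(n : ℝ)|) :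
    ‖trapezoidalSum (quadExp a b d) h - ∫ y, quadExp a b d y‖ ≤
      Real.sqrt Real.pi * (Real.exp K * (2 / (Real.exp r - 1))) := by
  have hbound : ∀ n : ℤ, ‖if n = 0 then 0 else quadCoeff a b d h n‖ ≤
      Real.exp K * (if n = 0 then 0 else Real.exp (-r * |(n : ℝ)|)) := by
    intro n
    split_ifs with hn
    · simp
    · rw [quadCoeff, Complex.norm_exp, ← Real.exp_add]
      exact Real.exp_le_exp.2 (by linarith [hK n hn])
  have hs := (hasSum_exp_neg_mul_natAbs hr).mul_left (Real.exp K)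
  have hsum0 : Summable fun n : ℤ => if n = 0 then 0 else quadCoeff a b d h n :=
    .of_norm_bounded hs.summable hbound
  -- `hK` says nothing at `n = 0`, but a single term does not affect summability.
  have hsum : Summable (quadCoeff a b d h) := by
    refine (summable_congr_cofinite ?_).1 hsum0
    filter_upwards [(Set.finite_singleton (0 : ℤ)).compl_mem_cofinite] with n hn
    exact if_neg hn
  rw [trapezoidalSum_quadExp ha b d hh, integral_quadExp ha b d h,
    hsum.tsum_eq_add_tsum_ite 0, mul_add, add_sub_cancel_left, norm_mul]
  refine mul_le_mul ?_ (tsum_of_norm_bounded hs hbound) (norm_nonneg _) (Real.sqrt_nonneg _)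
  refine Real.le_sqrt_of_sq_le ?_
  have : ((Real.pi / a : ℂ) ^ (1 / 2 : ℂ)) ^ 2 = Real.pi / a := by
    have := Complex.cpow_nat_inv_pow (Real.pi / a) (n := 2) (by norm_num)
    simpa only [one_div, Nat.cast_ofNat] using this
  rw [← norm_pow, this, norm_div, Complex.norm_real, Real.norm_of_nonneg Real.pi_pos.le]
  exact div_le_self Real.pi_pos.le ha1


/-! ### Gaussian tails and the numerical truncation bound -/

lemma integrable_exp_neg_sq : Integrable fun u : ℝ => Real.exp (-u ^ 2) := by
  simpa using integrable_exp_neg_mul_sq one_pos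

/-- Comparison of the right tail of a Gaussian sum with the tail of the Gaussian integral. -/
theorem mesh_mul_sum_exp_neg_sq_le {h v : ℝ} (hh : 0 < h) (hv : 0 ≤ v) (n : ℕ) :
    h * ∑ m ∈ Finset.range n, Real.exp (-(v + m * h) ^ 2) ≤
      h * Real.exp (-v ^ 2) + ∫ u in Ioi v, Real.exp (-u ^ 2) := by
  set f : ℝ → ℝ := fun y => Real.exp (-(h * y + v) ^ 2) with hf
  have hanti : AntitoneOn f (Icc 0 (0 + (n : ℝ))) := by
    intro y hy z hz hyz
    simp only [hf]
    refine Real.exp_le_exp.2 (neg_le_neg (pow_le_pow_left₀ ?_ ?_ 2))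
    · have := mul_nonneg hh.le hy.1; linarith
    · have := mul_le_mul_of_nonneg_left hyz hh.le; linarith
  have h1 := hanti.sum_le_integral
  simp only [hf, zero_add] at h1
  rw [intervalIntegral.integral_comp_mul_add (fun u => Real.exp (-u ^ 2)) hh.ne', mul_zero,
    zero_add, smul_eq_mul, inv_mul_eq_div, le_div_iff₀ hh] at h1
  have h2 : ∫ u in v..(h * n + v), Real.exp (-u ^ 2) ≤ ∫ u in Ioi v, Real.exp (-u ^ 2) := by
    rw [intervalIntegral.integral_of_le (by nlinarith [mul_nonneg hh.le n.cast_nonneg (α := ℝ)])]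
    exact setIntegral_mono_set integrable_exp_neg_sq.integrableOn
      (.of_forall fun u => (Real.exp_nonneg _)) Ioc_subset_Ioi_self.eventuallyLE
  -- One more nonnegative term is added so that the term `m = 0` splits off and `n` shifted terms
  -- remain for the integral comparison.
  have h3 : ∑ m ∈ Finset.range n, Real.exp (-(v + m * h) ^ 2) ≤
      Real.exp (-v ^ 2) + ∑ m ∈ Finset.range n, Real.exp (-(h * ((m + 1 : ℕ) : ℝ) + v) ^ 2) := by
    calc _ ≤ ∑ m ∈ Finset.range (n + 1), Real.exp (-(v + m * h) ^ 2) :=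
          Finset.sum_le_sum_of_subset_of_nonneg (Finset.range_mono n.le_succ)
            fun _ _ _ => Real.exp_nonneg _
      _ = _ := by
          rw [Finset.sum_range_succ', add_comm]
          congr 1
          · simp
          · exact Finset.sum_congr rfl fun m _ => by ring_nf
  nlinarith

/-- The tangent bound `u² ≥ 2vu - v²` gives an exponential majorant. -/
lemma integral_Ioi_exp_neg_sq_le {v : ℝ} (hv : 0 < v) :
    ∫ u in Ioi v, Real.exp (-u ^ 2) ≤ Real.exp (-v ^ 2) / (2 * v) := by
  have hneg : -(2 * v) < 0 := by linarith
  calc ∫ u in Ioi v, Real.exp (-u ^ 2)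
      ≤ ∫ u in Ioi v, Real.exp (v ^ 2) * Real.exp (-(2 * v) * u) := by
        refine setIntegral_mono integrable_exp_neg_sq.integrableOn
          ((integrableOn_exp_mul_Ioi hneg v).const_mul _) fun u => ?_
        rw [← Real.exp_add]
        exact Real.exp_le_exp.2 (by nlinarith [sq_nonneg (u - v)])
    _ = _ := by
        rw [integral_const_mul, integral_exp_mul_Ioi hneg, neg_div_neg_eq, ← mul_div_assoc,
          ← Real.exp_add]
        ring_nf

lemma sqrt_pi_mul_half_mul_erfc (v : ℝ) :
    Real.sqrt Real.pi * (1 / 2) * erfc v = ∫ u in Ioi v, Real.exp (-u ^ 2) := by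
  have : Real.sqrt Real.pi ≠ 0 := (Real.sqrt_pos.2 Real.pi_pos).ne'
  rw [erfc]
  field_simp

/-- A bilateral series minus a centred partial sum is the sum of its two tails. -/
theorem norm_sum_range_sub_tsum_le {f : ℤ → ℂ} (hf : Summable f) {N : ℕ} {g : ℕ → ℝ} {S : ℝ}
    (hg : ∀ n, ∑ m ∈ Finset.range n, g m ≤ S) (hright : ∀ m : ℕ, ‖f (N + m)‖ ≤ g m)
    (hleft : ∀ m : ℕ, ‖f (-(N + m + 1))‖ ≤ g m) :
    ‖∑ j ∈ Finset.range (2 * N), f ((j : ℤ) - N) - ∑' j, f j‖ ≤ 2 * S := by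
  have hg0 : ∀ m, 0 ≤ g m := fun m => (norm_nonneg _).trans (hright m)
  have hgs : Summable g := summable_of_sum_range_le hg0 hg
  have hgS : ∑' m, g m ≤ S := Real.tsum_le_of_sum_range_le hg0 hg
  have hF : Summable fun j : ℤ => f (j - N) := (Equiv.subRight (N : ℤ)).summable_iff.2 hf
  have hpos : Summable fun j : ℕ => f ((j : ℤ) - N) := hF.comp_injective Nat.cast_injective
  have hneg : Summable fun j : ℕ => f (-((j : ℤ) + 1) - N) :=
    hF.comp_injective (i := fun j : ℕ => -((j : ℤ) + 1)) fun a b hab => by simpa using hab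
  -- The window is `-N, …, N - 1`, so the tails start at `N` and at `-(N + 1)`.
  have e : ∑' j, f j = ∑ j ∈ Finset.range (2 * N), f ((j : ℤ) - N) +
      ∑' m : ℕ, f (((m + 2 * N : ℕ) : ℤ) - N) + ∑' m : ℕ, f (-((m : ℤ) + 1) - N) := by
    rw [hpos.sum_add_tsum_nat_add (2 * N), ← (Equiv.subRight (N : ℤ)).tsum_eq f]
    exact tsum_of_nat_of_neg_add_one hpos hneg
  have h1 : ‖∑' m : ℕ, f (((m + 2 * N : ℕ) : ℤ) - N)‖ ≤ S :=
    (tsum_of_norm_bounded hgs.hasSum fun m => by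
      rw [show ((m + 2 * N : ℕ) : ℤ) - N = N + m by push_cast; ring]
      exact hright m).trans hgS
  have h2 : ‖∑' m : ℕ, f (-((m : ℤ) + 1) - N)‖ ≤ S :=
    (tsum_of_norm_bounded hgs.hasSum fun m => by
      rw [show -((m : ℤ) + 1) - N = -(N + m + 1) by ring]
      exact hleft m).trans hgS
  rw [e, add_assoc, sub_add_cancel_left, norm_neg]
  linarith [norm_add_le (∑' m : ℕ, f (((m + 2 * N : ℕ) : ℤ) - N))
    (∑' m : ℕ, f (-((m : ℤ) + 1) - N))]

lemma sqrt_two_pi_mul_eight : Real.sqrt (2 * Real.pi * 8) = 4 * Real.sqrt Real.pi := by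
  rw [show 2 * Real.pi * 8 = 4 ^ 2 * Real.pi by ring, Real.sqrt_mul (by norm_num),
    Real.sqrt_sq (by norm_num)]

lemma truncationBound_eq (J : ℕ) : truncationBound (1 / 2) (5 / 2) 20 8 J =
    1 / Real.sqrt Real.pi * (20 / J * Real.exp (-(15 / 2) ^ 2) +
      ∫ u in Ioi (15 / 2), Real.exp (-u ^ 2)) := by
  rw [truncationBound, sqrt_two_pi_mul_eight, sqrt_pi_mul_half_mul_erfc]
  norm_num
  ring_nf

lemma truncationBound_le_one {J : ℕ} (hJ : 0 < J) :
    truncationBound (1 / 2) (5 / 2) 20 8 J ≤ truncationBound (1 / 2) (5 / 2) 20 8 1 := by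
  rw [truncationBound_eq, truncationBound_eq]
  have : (1 : ℝ) ≤ J := by exact_mod_cast hJ
  have h1 : (20 : ℝ) / J ≤ 20 / (1 : ℕ) := by
    rw [Nat.cast_one, div_one]; exact div_le_self (by norm_num) this
  gcongr

/-- The bound reduces to `(20 + 1/15) e^{-225/4} / √π ≈ 4.216 · 10⁻²⁴`. The margin is about one part
in a thousand, hence the sharp estimates of `√π` and `e`. -/
theorem truncationBound_one_lt :
    truncationBound (1 / 2) (5 / 2) 20 8 1 < 4.22 * (10 : ℝ) ^ (-24 : ℤ) := by
  rw [truncationBound_eq]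
  have h1 := integral_Ioi_exp_neg_sq_le (v := 15 / 2) (by norm_num)
  have hs : (1.77245 : ℝ) < Real.sqrt Real.pi :=
    Real.lt_sqrt_of_sq_lt (by linarith [Real.pi_gt_d6])
  have hq : (1.284 : ℝ) < Real.exp (1 / 4) := by
    have := Real.sum_le_exp_of_nonneg (x := 1 / 4) (by norm_num) 5
    norm_num [Finset.sum_range_succ, Nat.factorial] at this ⊢
    linarith
  have hexp : (2.7182818283 : ℝ) ^ 56 * 1.284 < Real.exp ((15 / 2) ^ 2) := by
    rw [show ((15 / 2 : ℝ)) ^ 2 = (56 : ℕ) * 1 + 1 / 4 by norm_num, Real.exp_add, Real.exp_nat_mul]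
    have h2 : (2.7182818283 : ℝ) ^ 56 ≤ Real.exp 1 ^ 56 :=
      pow_le_pow_left₀ (by norm_num) Real.exp_one_gt_d9.le 56
    exact mul_lt_mul' h2 hq (by norm_num) (by positivity)
  have hE : 0 < Real.exp ((15 / 2) ^ 2) := Real.exp_pos _
  have hs0 : 0 < Real.sqrt Real.pi := by linarith
  rw [Real.exp_neg] at h1 ⊢
  calc _ ≤ 1 / Real.sqrt Real.pi * (20 / (1 : ℕ) * (Real.exp ((15 / 2) ^ 2))⁻¹ +
        (Real.exp ((15 / 2) ^ 2))⁻¹ / (2 * (15 / 2))) := by gcongr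
    _ = (301 / 15) / (Real.sqrt Real.pi * Real.exp ((15 / 2) ^ 2)) := by
        rw [Nat.cast_one]; field_simp; norm_num
    _ < _ := by
        rw [div_lt_iff₀ (by positivity)]
        have := mul_lt_mul'' hs hexp (by norm_num) (by norm_num)
        refine lt_trans ?_ (mul_lt_mul_of_pos_left this (by norm_num))
        norm_num


/-! ### The packets at time 8 and the discretization error -/

/-- The quadratic coefficient `1 - i/16` of the exponent of the integrand at time `t = 8`. -/
def quadA : ℂ := 1 - Complex.I / 16

/-- The linear coefficient of the exponent of the integrand for a packet centred at `δ`. -/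
def linB (δ x : ℝ) : ℂ := 2 * δ - Complex.I * x / 8

/-- The constant coefficient of the exponent of the integrand for a packet centred at `δ`. -/
def constD (δ x : ℝ) : ℂ := Complex.I * x ^ 2 / 16 - δ ^ 2

lemma quadA_re : quadA.re = 1 := by simp [quadA]

lemma quadA_re_pos : 0 < quadA.re := by rw [quadA_re]; exact one_pos

lemma one_le_norm_quadA : 1 ≤ ‖quadA‖ := by
  have := Complex.abs_re_le_norm quadA
  rwa [quadA_re, abs_one] at this

/-- The constant prefactor of the packet with phase `φ` in the integrand at time `t = 8`. -/
def prefactor (φ : ℂ) : ℂ :=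
  Complex.exp (-Complex.I * Real.pi / 4) / (4 * Real.sqrt Real.pi : ℝ) * φ

lemma norm_exp_neg_I_mul_pi_div_four : ‖Complex.exp (-Complex.I * Real.pi / 4)‖ = 1 := by
  rw [show -Complex.I * (Real.pi : ℂ) / 4 = ((-(Real.pi / 4) : ℝ) : ℂ) * Complex.I by
    push_cast; ring, Complex.norm_exp_ofReal_mul_I]

lemma norm_exp_I_mul_pi_div_four : ‖Complex.exp (Complex.I * Real.pi / 4)‖ = 1 := by
  rw [show Complex.I * (Real.pi : ℂ) / 4 = ((Real.pi / 4 : ℝ) : ℂ) * Complex.I by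
    push_cast; ring, Complex.norm_exp_ofReal_mul_I]

lemma norm_prefactor {φ : ℂ} (hφ : ‖φ‖ = 1) : ‖prefactor φ‖ = 1 / (4 * Real.sqrt Real.pi) := by
  rw [prefactor, norm_mul, hφ, mul_one, norm_div, norm_exp_neg_I_mul_pi_div_four,
    Complex.norm_real, Real.norm_of_nonneg (by positivity)]

lemma propagator_mul_gaussian (φ : ℂ) (δ x y : ℝ) :
    propagator (x - y) 8 * (φ * (Real.exp (-(y - δ) ^ 2) : ℂ)) =
      prefactor φ * quadExp quadA (linB δ x) (constD δ x) y := by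
  have e : Complex.exp (Complex.I * ((x - y : ℝ) : ℂ) ^ 2 / (2 * ((8 : ℝ) : ℂ))) *
      (Real.exp (-(y - δ) ^ 2) : ℂ) = quadExp quadA (linB δ x) (constD δ x) y := by
    rw [quadExp, Complex.ofReal_exp, ← Complex.exp_add, quadA, linB, constD]
    congr 1
    push_cast
    ring
  rw [propagator, prefactor, sqrt_two_pi_mul_eight, ← e]
  ring

lemma integrand_twoGaussians (x : ℝ) : integrand (twoGaussians (1 / 2) (5 / 2)) x 8 = fun y =>
    prefactor (Complex.exp (Complex.I * Real.pi / 4)) *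
        quadExp quadA (linB (5 / 2) x) (constD (5 / 2) x) y +
      prefactor (Complex.exp (-Complex.I * Real.pi / 4)) *
        quadExp quadA (linB (-(5 / 2)) x) (constD (-(5 / 2)) x) y := by
  funext y
  rw [← propagator_mul_gaussian, ← propagator_mul_gaussian, ← mul_add, integrand, twoGaussians]
  norm_num

lemma integrable_integrand (x : ℝ) :
    Integrable (integrand (twoGaussians (1 / 2) (5 / 2)) x 8) := by
  rw [integrand_twoGaussians]
  exact ((integrable_quadExp quadA_re_pos _ _).const_mul _).add
    ((integrable_quadExp quadA_re_pos _ _).const_mul _)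

lemma summable_integrand (x : ℝ) {h : ℝ} (hh : 0 < h) :
    Summable fun j : ℤ => integrand (twoGaussians (1 / 2) (5 / 2)) x 8 (j * h) := by
  simp only [integrand_twoGaussians]
  exact ((summable_quadExp quadA_re_pos _ _ hh).mul_left _).add
    ((summable_quadExp quadA_re_pos _ _ hh).mul_left _)

/-- This is the exponent of the spread packet evaluated at `x + 16πξ`: frequency `ξ` moves it by `t
· 2πξ`, and `257 = 1 + (t / (2σ²))²` is the spreading factor. -/
lemma quadCoeff_exponent_re (δ x ξ : ℝ) :
    ((linB δ x - 2 * Real.pi * Complex.I * ξ) ^ 2 / (4 * quadA) + constD δ x).re =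
      -(δ - x - 16 * Real.pi * ξ) ^ 2 / 257 := by
  have hA : quadA * (1 + Complex.I / 16) = 257 / 256 := by
    rw [quadA]; linear_combination -(1 / 256) * Complex.I_sq
  have hinv : (4 * quadA)⁻¹ = (64 / 257) * (1 + Complex.I / 16) :=
    inv_eq_of_mul_eq_one_right (by linear_combination (256 / 257) * hA)
  have e2 : linB δ x - 2 * Real.pi * Complex.I * ξ =
      ((2 * δ : ℝ) : ℂ) - ((x / 8 + 2 * Real.pi * ξ : ℝ) : ℂ) * Complex.I := by
    rw [linB]; push_cast; ring
  rw [div_eq_mul_inv, hinv, e2, constD]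
  generalize hη : x / 8 + 2 * Real.pi * ξ = η
  have e3 : (((2 * δ : ℝ) : ℂ) - (η : ℂ) * Complex.I) ^ 2 * ((64 / 257) * (1 + Complex.I / 16)) +
      (Complex.I * x ^ 2 / 16 - δ ^ 2) = ((-(δ - 8 * η) ^ 2 / 257 : ℝ) : ℂ) +
      (((4 * δ ^ 2 - η ^ 2) * 4 / 257 - 256 * δ * η / 257 + x ^ 2 / 16 : ℝ) : ℂ) * Complex.I := by
    push_cast
    linear_combination ((64 / 257) * η ^ 2 * (1 + Complex.I / 16) - 16 / 257 * δ * η) *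
      Complex.I_sq
  rw [e3, Complex.add_re, Complex.ofReal_re, Complex.re_ofReal_mul, Complex.I_re, ← hη]
  ring

lemma quadCoeff_exponent_re_le (δ x ξ : ℝ) {c : ℝ} (hc : 0 < c) :
    -(δ - x - 16 * Real.pi * ξ) ^ 2 / 257 ≤
      257 / 256 * c ^ 2 + (1 / 8 * |x| + |δ| / 8) * c - 2 * Real.pi * c * |ξ| := by
  have hx := neg_abs_le x
  have hx' := le_abs_self x
  have hd := neg_abs_le δ
  have hd' := le_abs_self δ
  have hp := Real.pi_pos
  -- This is `(u + 257c/16)² ≥ 0`. Below, `u` is `±(δ - x - 16πξ)`, signed so that its frequency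
  -- part is `-16π|ξ|`.
  have key : ∀ u : ℝ, -u ^ 2 / 257 ≤ 257 / 256 * c ^ 2 + c / 8 * u := fun u => by
    nlinarith [sq_nonneg (u + 257 * c / 16)]
  rcases abs_cases ξ with ⟨h, -⟩ | ⟨h, -⟩ <;> rw [h]
  · refine (key _).trans ?_
    nlinarith
  · rw [← neg_sq]
    refine (key _).trans ?_
    nlinarith

lemma norm_trapezoidalSum_packet_sub_integral_le (δ x : ℝ) {h c : ℝ} (hh : 0 < h) (hc : 0 < c) :
    ‖trapezoidalSum (quadExp quadA (linB δ x) (constD δ x)) h -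
        ∫ y, quadExp quadA (linB δ x) (constD δ x) y‖ ≤
      Real.sqrt Real.pi * (Real.exp (257 / 256 * c ^ 2 + (1 / 8 * |x| + |δ| / 8) * c) *
        (2 / (Real.exp (2 * Real.pi * c / h) - 1))) := by
  have hp := Real.pi_pos
  refine norm_trapezoidalSum_quadExp_sub_integral_le quadA_re_pos one_le_norm_quadA _ _ hh
    (by positivity) fun n _ => ?_
  have e : 2 * Real.pi * Complex.I * n / h = 2 * Real.pi * Complex.I * ((n / h : ℝ) : ℂ) := by
    push_cast; ring
  rw [e, quadCoeff_exponent_re]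
  refine (quadCoeff_exponent_re_le δ x (n / h) hc).trans_eq ?_
  rw [abs_div, abs_of_pos hh]
  ring

theorem discretizationError_le {J : ℕ} (hJ : 0 < J) (x : ℝ) {c : ℝ} (hc : 0 < c) :
    discretizationError (twoGaussians (1 / 2) (5 / 2)) 20 J x 8 ≤
      Real.exp (257 / 256 * c ^ 2 + (1 / 8 * |x| + 5 / 16) * c) /
        (Real.exp (Real.pi * c * J / 10) - 1) := by
  have hJ' : (0 : ℝ) < J := by exact_mod_cast hJ
  have hh : 0 < meshSize 20 J := by rw [meshSize]; positivity
  have hs : 0 < Real.sqrt Real.pi := Real.sqrt_pos.2 Real.pi_pos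
  have h1 := norm_trapezoidalSum_packet_sub_integral_le (5 / 2) x hh hc
  have h2 := norm_trapezoidalSum_packet_sub_integral_le (-(5 / 2)) x hh hc
  have hr : 2 * Real.pi * c / meshSize 20 J = Real.pi * c * J / 10 := by
    rw [meshSize]; field_simp; norm_num
  rw [hr] at h1 h2
  rw [abs_neg] at h2
  rw [show |(5 / 2 : ℝ)| / 8 = 5 / 16 by rw [abs_of_pos] <;> norm_num] at h1 h2
  have hE : 0 < Real.exp (Real.pi * c * J / 10) - 1 := by
    have := Real.pi_pos
    rw [sub_pos, Real.one_lt_exp_iff]; positivity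
  rw [discretizationError, solution, integrand_twoGaussians, trapezoidalSum,
    (((summable_quadExp quadA_re_pos _ _ hh).mul_left _).tsum_add
      ((summable_quadExp quadA_re_pos _ _ hh).mul_left _)),
    integral_add ((integrable_quadExp quadA_re_pos _ _).const_mul _)
      ((integrable_quadExp quadA_re_pos _ _).const_mul _),
    integral_const_mul, integral_const_mul, tsum_mul_left, tsum_mul_left]
  rw [trapezoidalSum] at h1 h2
  set P := prefactor (Complex.exp (Complex.I * Real.pi / 4)) with hP
  set Q := prefactor (Complex.exp (-Complex.I * Real.pi / 4)) with hQ
  have nP : ‖P‖ = _ := norm_prefactor norm_exp_I_mul_pi_div_four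
  have nQ : ‖Q‖ = _ := norm_prefactor norm_exp_neg_I_mul_pi_div_four
  have split : ∀ m S T U V : ℂ, m * (P * S + Q * T) - (P * U + Q * V) =
      P * (m * S - U) + Q * (m * T - V) := fun m S T U V => by ring
  rw [split]
  refine (norm_add_le _ _).trans ?_
  rw [norm_mul, norm_mul, nP, nQ, ← mul_add]
  -- The constants cancel: two packets, each with `1/(4√π) · √π · 2 = 1/2`.
  refine (mul_le_mul_of_nonneg_left (add_le_add h1 h2) (by positivity)).trans_eq ?_
  field_simp
  norm_num

/-! ### The truncation error and the total error -/

lemma norm_propagator_eight (x : ℝ) : ‖propagator x 8‖ = 1 / (4 * Real.sqrt Real.pi) := by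
  rw [propagator, norm_mul, norm_div, norm_exp_neg_I_mul_pi_div_four, sqrt_two_pi_mul_eight,
    Complex.norm_real, Real.norm_of_nonneg (by positivity),
    show Complex.I * (x : ℂ) ^ 2 / (2 * ((8 : ℝ) : ℂ)) = ((x ^ 2 / 16 : ℝ) : ℂ) * Complex.I by
      push_cast; ring, Complex.norm_exp_ofReal_mul_I, mul_one]

lemma norm_integrand_le (x : ℝ) {y v : ℝ} (hv : 0 ≤ v) (hy : v + 5 / 2 ≤ |y|) :
    ‖integrand (twoGaussians (1 / 2) (5 / 2)) x 8 y‖ ≤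
      1 / (2 * Real.sqrt Real.pi) * Real.exp (-v ^ 2) := by
  have hs : 0 < Real.sqrt Real.pi := Real.sqrt_pos.2 Real.pi_pos
  have h1 : v ^ 2 ≤ (y - 5 / 2) ^ 2 := by
    rcases abs_cases y with ⟨h, -⟩ | ⟨h, -⟩ <;> rw [h] at hy <;> nlinarith
  have h2 : v ^ 2 ≤ (y + 5 / 2) ^ 2 := by
    rcases abs_cases y with ⟨h, -⟩ | ⟨h, -⟩ <;> rw [h] at hy <;> nlinarith
  have hψ : ‖twoGaussians (1 / 2) (5 / 2) y‖ ≤ 2 * Real.exp (-v ^ 2) := by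
    rw [twoGaussians]
    refine (norm_add_le _ _).trans ?_
    rw [norm_mul, norm_mul, norm_exp_I_mul_pi_div_four, norm_exp_neg_I_mul_pi_div_four,
      Complex.norm_real, Complex.norm_real, Real.norm_of_nonneg (Real.exp_nonneg _),
      Real.norm_of_nonneg (Real.exp_nonneg _), one_mul, one_mul, two_mul]
    refine add_le_add (Real.exp_le_exp.2 ?_) (Real.exp_le_exp.2 ?_) <;> norm_num <;> linarith
  rw [integrand, norm_mul, norm_propagator_eight]
  refine (mul_le_mul_of_nonneg_left hψ (by positivity)).trans_eq ?_
  field_simp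
  norm_num

theorem truncationError_le {J : ℕ} (hJ : 0 < J) (hJeven : Even J) (x : ℝ) :
    truncationError (twoGaussians (1 / 2) (5 / 2)) 20 J x 8 ≤
      truncationBound (1 / 2) (5 / 2) 20 8 J := by
  obtain ⟨N, rfl⟩ := hJeven
  have hN : (0 : ℝ) < N := by exact_mod_cast (by omega : 0 < N)
  set h := meshSize 20 (N + N) with hh
  have hNh : N * h = 10 := by rw [hh, meshSize]; push_cast; field_simp; norm_num
  have hpos : 0 < h := by rw [hh, meshSize]; push_cast; positivity
  have hs : 0 < Real.sqrt Real.pi := Real.sqrt_pos.2 Real.pi_pos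
  set F := integrand (twoGaussians (1 / 2) (5 / 2)) x 8 with hF
  have hsum := summable_integrand x hpos
  set I := ∫ u in Ioi (15 / 2 : ℝ), Real.exp (-u ^ 2) with hI
  have hg : ∀ n, ∑ m ∈ Finset.range n,
      1 / (2 * Real.sqrt Real.pi) * Real.exp (-(15 / 2 + m * h) ^ 2) ≤
      1 / (2 * Real.sqrt Real.pi) * ((h * Real.exp (-(15 / 2) ^ 2) + I) / h) := fun n => by
    rw [← Finset.mul_sum]
    refine mul_le_mul_of_nonneg_left ?_ (by positivity)
    rw [le_div_iff₀' hpos]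
    exact mesh_mul_sum_exp_neg_sq_le hpos (by norm_num) n
  -- Since `N h = 10 = 15/2 + 5/2`, the right tail starts exactly at `v = 15/2`; the left one starts
  -- a mesh further out, so the same majorant serves.
  have h1 := norm_sum_range_sub_tsum_le (f := fun j : ℤ => F (j * h)) hsum (N := N) hg
    (fun m => norm_integrand_le x (by positivity) (by
      rw [abs_of_nonneg (by positivity)]; push_cast; nlinarith))
    (fun m => norm_integrand_le x (by positivity) (by
      push_cast; rw [neg_mul, abs_neg, abs_of_nonneg (by positivity)]; nlinarith))
  have e : approximation (twoGaussians (1 / 2) (5 / 2)) 20 (N + N) x 8 = (h : ℂ) *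
      ∑ j ∈ Finset.range (2 * N), F ((((j : ℤ) - N : ℤ) : ℝ) * h) := by
    rw [approximation, two_mul N]
    refine congrArg _ (Finset.sum_congr rfl fun j _ => ?_)
    have : gridPoint 20 (N + N) j = (((j : ℤ) - N : ℤ) : ℝ) * h := by
      rw [gridPoint, hh]; push_cast; ring
    rw [this, hF, integrand]
  rw [truncationError, e, trapezoidalSum, ← mul_sub, norm_mul, Complex.norm_real,
    Real.norm_of_nonneg hpos.le]
  refine (mul_le_mul_of_nonneg_left h1 hpos.le).trans_eq ?_
  rw [truncationBound_eq, ← hI]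
  change _ = 1 / Real.sqrt Real.pi * (h * _ + I)
  field_simp

lemma norm_error_le_truncation_add_discretization (ψ₀ : ℝ → ℂ) (L : ℝ) (J : ℕ) (x t : ℝ) :
    ‖approximation ψ₀ L J x t - solution ψ₀ x t‖ ≤
      truncationError ψ₀ L J x t + discretizationError ψ₀ L J x t :=
  norm_sub_le_norm_sub_add_norm_sub _ _ _

theorem norm_error_le_errorBound {J : ℕ} (hJ : 0 < J) (hJeven : Even J) {c : ℝ} (hc : 0 < c)
    {x : ℝ} (hx : x ∈ Icc (-40 : ℝ) 40) :
    ‖approximation (twoGaussians (1 / 2) (5 / 2)) 20 J x 8 -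
        solution (twoGaussians (1 / 2) (5 / 2)) x 8‖ ≤ errorBound c J := by
  have hJ' : (0 : ℝ) < J := by exact_mod_cast hJ
  have hE : 0 ≤ Real.exp (Real.pi * c * J / 10) - 1 := by
    have := Real.pi_pos
    rw [sub_nonneg, Real.one_le_exp_iff]; positivity
  have h1 := norm_error_le_truncation_add_discretization (twoGaussians (1 / 2) (5 / 2)) 20 J x 8
  have h2 := (truncationError_le hJ hJeven x).trans
    ((truncationBound_le_one hJ).trans truncationBound_one_lt.le)
  have h3 : discretizationError (twoGaussians (1 / 2) (5 / 2)) 20 J x 8 ≤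
      Real.exp (257 / 256 * c ^ 2 + 85 / 16 * c) / (Real.exp (Real.pi * c * J / 10) - 1) := by
    refine (discretizationError_le hJ x hc).trans (div_le_div_of_nonneg_right ?_ hE)
    refine Real.exp_le_exp.2 ?_
    -- `40/8 + 5/16 = 85/16`.
    have : |x| ≤ 40 := abs_le.2 hx
    nlinarith
  rw [errorBound]
  linarith

end FreeWavePacket

end
theorem mainTheorem2 (J : ℕ) (hJ : 0 < J) (hJeven : Even J) (c : ℝ) (hc : 0 < c) :
    -- the total error in the supremum norm on `[-40, 40]`
    eLpNorm
        (fun x : ℝ =>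
          FreeWavePacket.approximation (FreeWavePacket.twoGaussians (1 / 2) (5 / 2)) 20 J x 8 -
            FreeWavePacket.solution (FreeWavePacket.twoGaussians (1 / 2) (5 / 2)) x 8)
        ⊤ (volume.restrict (Icc (-40 : ℝ) 40))
      ≤ ENNReal.ofReal (FreeWavePacket.errorBound c J) ∧
    (∀ x ∈ Icc (-40 : ℝ) 40,
      -- the integral and the series involved converge absolutely
      Integrable
        (FreeWavePacket.integrand (FreeWavePacket.twoGaussians (1 / 2) (5 / 2)) x 8) ∧
      Summable (fun j : ℤ =>
        FreeWavePacket.integrand (FreeWavePacket.twoGaussians (1 / 2) (5 / 2)) x 8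
          ((j : ℝ) * FreeWavePacket.meshSize 20 J)) ∧
      -- the total error at every point
      ‖FreeWavePacket.approximation (FreeWavePacket.twoGaussians (1 / 2) (5 / 2)) 20 J x 8 -
          FreeWavePacket.solution (FreeWavePacket.twoGaussians (1 / 2) (5 / 2)) x 8‖
        ≤ FreeWavePacket.errorBound c J ∧
      -- the splitting into truncation and discretization error
      ‖FreeWavePacket.approximation (FreeWavePacket.twoGaussians (1 / 2) (5 / 2)) 20 J x 8 -
          FreeWavePacket.solution (FreeWavePacket.twoGaussians (1 / 2) (5 / 2)) x 8‖
        ≤ FreeWavePacket.truncationError (FreeWavePacket.twoGaussians (1 / 2) (5 / 2)) 20 J x 8 +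
          FreeWavePacket.discretizationError
            (FreeWavePacket.twoGaussians (1 / 2) (5 / 2)) 20 J x 8 ∧
      -- the truncation error
      FreeWavePacket.truncationError (FreeWavePacket.twoGaussians (1 / 2) (5 / 2)) 20 J x 8
        ≤ FreeWavePacket.truncationBound (1 / 2) (5 / 2) 20 8 J ∧
      -- the discretization error
      FreeWavePacket.discretizationError (FreeWavePacket.twoGaussians (1 / 2) (5 / 2)) 20 J x 8
        ≤ Real.exp (257 / 256 * c ^ 2 + (1 / 8 * |x| + 5 / 16) * c) /
            (Real.exp (Real.pi * c * J / 10) - 1)) ∧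
    -- the numerical value of the bound of the truncation error
    FreeWavePacket.truncationBound (1 / 2) (5 / 2) 20 8 J
      ≤ FreeWavePacket.truncationBound (1 / 2) (5 / 2) 20 8 1 ∧
    FreeWavePacket.truncationBound (1 / 2) (5 / 2) 20 8 1 < 4.22 * (10 : ℝ) ^ (-24 : ℤ) := by
  refine ⟨?_, fun x hx => ?_, FreeWavePacket.truncationBound_le_one hJ,
    FreeWavePacket.truncationBound_one_lt⟩
  · rw [eLpNorm_exponent_top]
    refine eLpNormEssSup_le_of_ae_bound ?_
    filter_upwards [ae_restrict_mem measurableSet_Icc] with x hx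
    exact FreeWavePacket.norm_error_le_errorBound hJ hJeven hc hx
  · have hJ' : (0 : ℝ) < J := by exact_mod_cast hJ
    have hh : 0 < FreeWavePacket.meshSize 20 J := by rw [FreeWavePacket.meshSize]; positivity
    exact ⟨FreeWavePacket.integrable_integrand x, FreeWavePacket.summable_integrand x hh,
      FreeWavePacket.norm_error_le_errorBound hJ hJeven hc hx,
      FreeWavePacket.norm_error_le_truncation_add_discretization _ _ _ _ _,
      FreeWavePacket.truncationError_le hJ hJeven x,
      FreeWavePacket.discretizationError_le hJ x hc⟩
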